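/- Let $\mathcal A$ be an abelian length category, i.e. an abelian category in which every object has a composition series. Subcategories are full, closed under isomorphisms and contain $0$. A torsion class is a subcategory closed under quotients and extensions; $L:=\operatorname{tors}\mathcal A$ denotes the complete lattice of torsion classes ordered by inclusion. A wide subcategory is a subcategory closed under kernels, cokernels and extensions; $\operatorname{wide}\mathcal A$ denotes the poset of wide subcategories ordered by inclusion. For a subcategory $\mathcal C$ let $T(\mathcal C)$ be the smallest torsion class containing $\mathcal C$. An element $j$ of a complete lattice $L$ is completely join-irreducible if $j=\bigvee X$ with $X\subseteq L$ implies $j\in X$; put $a_*:=\bigvee\{x\in L\mid x<a\}$. A complete lattice is completely semidistributive if for all $a,b\in L$ and every nonempty $X\subseteq L$: $a\vee x=b$ for all $x\in X$ implies $a\vee\bigwedge X=b$, and $a\wedge x=b$ for all $x\in X$ implies $a\wedge\bigvee X=b$. In such a lattice put $\kappa(j):=\max\{x\in L\mid j\wedge x=j_*\}$ for $j$ completely join-irreducible and, for $a\le b$, $\operatorname{jlabel}[a,b]:=\{j \text{ completely join-irreducible}\mid j\le b,\ \kappa(j)\ge a\}$. A canonical join representation of $x\in L$ is an expression $x=\bigvee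 A$ with $A\subseteq L$ an antichain such that, whenever $x=\bigvee B$ with $B\subseteq L$, every $a\in A$ satisfies $a\le b$ for some $b\in B$; it is unique if it exists, its elements are completely join-irreducible, and $L_0$ denotes the set of $x\in L$ that have one. For $x\in L_0$ with canonical join representation $x=\bigvee A$ put $\bar\kappa(x):=\bigwedge\{\kappa(a)\mid a\in A\}$ and $x_\downarrow:=x\wedge\bigwedge\{x'\in L\mid x' \text{ is covered by } x\}$. On $L_0$ define $$x\le_\kappa y :\iff x\le y \text{ and } \bar\kappa(x)\ge\bar\kappa(y)\qquad\text{(kappa order)},$$ $$x\le_{\mathrm{clo}} y :\iff \operatorname{jlabel}[x_\downarrow,x]\subseteq\operatorname{jlabel}[y_\downarrow,y]\qquad\text{(core label order)}.$$ Then $L=\operatorname{tors}\mathcal A$ is completely semidistributive, $\le_\kappa$ and $\le_{\mathrm{clo}}$ are partial orders on $L_0$, these two orders coincide, and $\mathcal W\mapsto T(\mathcal W)$ defines an isomorphism of posets $$\operatorname{wide}\mathcal A\;\xrightarrow{\ \sim\ }\;(L_0,\le_\kappa)=(L_0,\le_{\mathrm{clo}}).$$ -/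

import Mathlib

open CategoryTheory CategoryTheory.Limits

universe v u

namespace TorsLattice

/-! ### Complete lattices -/

section Lattice

variable {L : Type*} [CompleteLattice L]

/-- Completely semidistributive complete lattices (the families are nonempty, as usual). -/
structure CompletelySemidistributive (L : Type*) [CompleteLattice L] : Prop where
  sup_sInf : ∀ (a b : L) (X : Set L), X.Nonempty → (∀ x ∈ X, a ⊔ x = b) → a ⊔ sInf X = b
  inf_sSup : ∀ (a b : L) (X : Set L), X.Nonempty → (∀ x ∈ X, a ⊓ x = b) → a ⊓ sSup X = b

/-- `j` is completely join-irreducible: `j = ⋁ X` implies `j ∈ X`. For `X = ∅` this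
excludes the least element. -/
def CompletelyJoinIrreducible (j : L) : Prop :=
  ∀ X : Set L, j = sSup X → j ∈ X

/-- `a_* = ⋁ {x | x < a}`. -/
def lowerStar (a : L) : L := sSup {x | x < a}

/-- The kappa map `κ(j) = max {x | j ∧ x = j_*}`; the supremum is a maximum in a completely
semidistributive lattice, see `isGreatest_kappa`. -/
def kappa (j : L) : L := sSup {x | j ⊓ x = lowerStar j}

theorem isGreatest_kappa (hL : CompletelySemidistributive L) (j : L) :
    IsGreatest {x | j ⊓ x = lowerStar j} (kappa j) := by
  refine ⟨hL.inf_sSup j (lowerStar j) _ ⟨lowerStar j, ?_⟩ fun x hx => hx, fun x hx => le_sSup hx⟩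
  exact inf_eq_right.2 (sSup_le fun x hx => le_of_lt hx)

/-- `jlabel [a, b]`: the completely join-irreducible `j` with `j ≤ b` and `κ(j) ≥ a`. -/
def jlabel (a b : L) : Set L :=
  {j | CompletelyJoinIrreducible j ∧ j ≤ b ∧ a ≤ kappa j}

/-- `x = ⋁ A` is a canonical join representation: `A` refines every join representation of `x`,
and `A` is an antichain. -/
structure IsCanonicalJoinRep (A : Set L) (x : L) : Prop where
  sSup_eq : sSup A = x
  refines : ∀ B : Set L, sSup B = x → ∀ a ∈ A, ∃ b ∈ B, a ≤ b
  antichain : ∀ a₁ ∈ A, ∀ a₂ ∈ A, a₁ ≤ a₂ → a₁ = a₂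

theorem IsCanonicalJoinRep.unique {A B : Set L} {x : L}
    (hA : IsCanonicalJoinRep A x) (hB : IsCanonicalJoinRep B x) : A = B := by
  have key : ∀ {A B : Set L}, IsCanonicalJoinRep A x → IsCanonicalJoinRep B x → A ⊆ B := by
    intro A B hA hB a ha
    obtain ⟨b, hb, hab⟩ := hA.refines B hB.sSup_eq a ha
    obtain ⟨c, hc, hbc⟩ := hB.refines A hA.sSup_eq b hb
    have hac : a = c := hA.antichain a ha c hc (hab.trans hbc)
    have : a = b := le_antisymm hab (hac ▸ hbc)
    exact this ▸ hb
  exact Set.Subset.antisymm (key hA hB) (key hB hA)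

/-- `L₀`: the elements with a canonical join representation. -/
abbrev L₀ (L : Type*) [CompleteLattice L] : Type _ :=
  {x : L // ∃ A : Set L, IsCanonicalJoinRep A x}

/-- The (unique) canonical join representation of `x ∈ L₀`. -/
noncomputable def CJR (x : L₀ L) : Set L := Classical.choose x.2

/-- The extended kappa map `L₀ → L`. -/
noncomputable def extKappa (x : L₀ L) : L := sInf (kappa '' CJR x)

/-- The kappa order on `L₀`. -/
def KappaLE (x y : L₀ L) : Prop := (x : L) ≤ y ∧ extKappa y ≤ extKappa x

/-- `x_↓ = x ∧ ⋀ {x' | x' ⋖ x}`. -/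
def downArrow (x : L) : L := x ⊓ sInf {x' | x' ⋖ x}

/-- The core label order on `L₀`. -/
def CoreLabelLE (x y : L₀ L) : Prop :=
  jlabel (downArrow (x : L)) (x : L) ⊆ jlabel (downArrow (y : L)) (y : L)

end Lattice

/-! ### Abelian length categories, torsion classes, wide subcategories -/

section Category

variable (C : Type u) [Category.{v} C] [Abelian C]

/-- Composition series `0 = F 0 ⊆ F 1 ⊆ ⋯ ⊆ F n = X` with simple quotients. -/
def HasCompositionSeries {C : Type u} [Category.{v} C] [Abelian C] (X : C) : Prop :=
  ∃ (n : ℕ) (F : ℕ → Subobject X) (hF : ∀ i, F i ≤ F (i + 1)),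
    F 0 = ⊥ ∧ F n = ⊤ ∧
      ∀ i < n, Simple (cokernel ((F i).ofLE (F (i + 1)) (hF i)))

/-- Abelian length categories: every object has a composition series. -/
def IsLengthCategory : Prop := ∀ X : C, HasCompositionSeries X

/-- Torsion classes: full subcategories containing zero, closed under quotients and extensions
(and hence under isomorphisms). -/
structure IsTorsionClass {C : Type u} [Category.{v} C] [Abelian C]
    (P : ObjectProperty C) : Prop where
  containsZero : P.ContainsZero
  quotients : P.IsClosedUnderQuotients
  extensions : P.IsClosedUnderExtensions

/-- Wide subcategories: full subcategories containing zero, closed under extensions, kernels and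
cokernels (and hence under isomorphisms). -/
structure IsWide {C : Type u} [Category.{v} C] [Abelian C] (P : ObjectProperty C) : Prop where
  containsZero : P.ContainsZero
  extensions : P.IsClosedUnderExtensions
  kernels : P.IsClosedUnderKernels
  cokernels : P.IsClosedUnderCokernels

/-- The poset of torsion classes, ordered by inclusion. -/
abbrev Tors : Type _ := {P : ObjectProperty C // IsTorsionClass P}

/-- The poset of wide subcategories, ordered by inclusion. -/
abbrev Wide : Type _ := {P : ObjectProperty C // IsWide P}

/-- The intersection of a family of torsion classes. -/
def torsInter (S : Set (Tors C)) : Tors C where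
  val := fun X => ∀ T ∈ S, T.1 X
  property :=
    { containsZero := by
        obtain ⟨Z, hZ⟩ := HasZeroObject.zero (C := C)
        exact ⟨Z, hZ, fun T _ => by
          have := T.2.containsZero
          have := T.2.quotients
          exact T.1.prop_of_isZero hZ⟩
      quotients := ⟨fun f _ h T hT => by
        have := T.2.quotients
        exact T.1.prop_of_epi f (h T hT)⟩
      extensions := ⟨fun hS h₁ h₃ T hT => by
        have := T.2.extensions
        exact T.1.prop_X₂_of_shortExact hS (h₁ T hT) (h₃ T hT)⟩ }

instance : InfSet (Tors C) := ⟨torsInter C⟩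

/-- Torsion classes form a complete lattice under inclusion, with intersections as meets. -/
instance : CompleteLattice (Tors C) :=
  completeLatticeOfInf (Tors C) fun _ =>
    ⟨fun _ hT _ hX => hX _ hT, fun _ hU X hX T hT => hU hT X hX⟩

/-- `T(P)`: the smallest torsion class containing `P`. -/
def torsClosure {C : Type u} [Category.{v} C] [Abelian C] (P : ObjectProperty C) : Tors C :=
  sInf {T : Tors C | P ≤ T.1}

end Category

end TorsLattice

/-! Semibricks link the two sides. For a semibrick `S` write T(S), F(S) for the torsion and
torsion-free classes it generates (`torsHull`, `torfHull`) and ⊥S for the objects with no nonzero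
map to `S`. Then T(S) ∩ F(S) is wide (`IsSemibrick.isWide`). Conversely, the simple objects of a
wide `W` form a semibrick `S` with `W` = T(S) ∩ F(S) and T(W) = T(S) (`IsWide.eq_hulls`,
`IsWide.torsClosure_wideSimples`).

On the lattice side, the completely join-irreducibles are the T(B) with `B` a brick, and κ(T(B)) =
⊥B. The canonical join representations are the families T(B), `B` in a semibrick `S`, with join x =
T(S) (`IsSemibrick.isCanonicalJoinRep`, `IsCanonicalJoinRep.exists_isSemibrick`). Hence κ̄(x) = ⊥S
and x_↓ = T(S) ∩ ⊥S. So the inverse of W ↦ T(W) sends x to `wideProp x` = T(S) ∩ F(S), and the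
labels of [x_↓, x] are the T(B) for bricks `B` in `wideProp x`. Inclusions of these wide
subcategories can be tested on `S`, so both orders amount to inclusion of `wideProp`.

Complete semidistributivity is separate: a failed inclusion of torsion classes is witnessed by a
nonzero object with controlled proper subobjects or quotients. -/

namespace TorsLattice

set_option linter.unusedSectionVars false

/-! ### Chain conditions from composition series -/

section FiniteLength

variable {C : Type u} [Category.{v} C] [Abelian C]

/-- `Y` admits a monomorphism to `X` that is not an isomorphism. -/
def ProperSub (Y X : C) : Prop := ∃ f : Y ⟶ X, Mono f ∧ ¬ IsIso f

/-- `X` admits an epimorphism to `Y` that is not an isomorphism. -/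
def ProperQuot (Y X : C) : Prop := ∃ f : X ⟶ Y, Epi f ∧ ¬ IsIso f

lemma shortExact_kernel {X Y : C} (p : X ⟶ Y) [Epi p] :
    (ShortComplex.mk (kernel.ι p) p (kernel.condition p)).ShortExact where
  exact := ShortComplex.exact_kernel p

lemma shortExact_cokernel {X Y : C} (i : X ⟶ Y) [Mono i] :
    (ShortComplex.mk i (cokernel.π i) (cokernel.condition i)).ShortExact where
  exact := ShortComplex.exact_cokernel i

lemma isIso_of_mono_comp_isIso {X Y Z : C} (f : X ⟶ Y) (g : Y ⟶ Z) [Mono g]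
    (h : IsIso (f ≫ g)) : IsIso f ∧ IsIso g := by
  have : Epi g := epi_of_epi f g
  have : IsIso g := isIso_of_mono_of_epi g
  exact ⟨IsIso.of_isIso_comp_right f g, this⟩

/-- Double induction on the bounds `K` and `Q`. A proper subobject of the middle term induces
subobjects of the two ends. By the five lemma their embeddings into `K` and `Q` are not both
isomorphisms, so a bound drops. Separating bounds from ends avoids transport along isomorphisms. -/
lemma acc_properSub_of_shortExact_aux {K : C} (hK : Acc ProperSub K) :
    ∀ {Q : C}, Acc ProperSub Q → ∀ {S : ShortComplex C}, S.ShortExact →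
      ∀ (k : S.X₁ ⟶ K) (q : S.X₃ ⟶ Q), Mono k → Mono q → Acc ProperSub S.X₂ := by
  induction hK with
  | intro K hK ihK =>
  intro Q hQ
  induction hQ with
  | intro Q hQ ihQ =>
  intro S hS k q hk hq
  refine ⟨_, fun Y => ?_⟩
  rintro ⟨f, hf, hf'⟩
  have := hS.mono_f
  have := hS.epi_g
  let S' : ShortComplex C := ShortComplex.mk (kernel.ι (factorThruImage (f ≫ S.g)))
    (factorThruImage (f ≫ S.g)) (kernel.condition _)
  have hS' : S'.ShortExact := shortExact_kernel _
  have hz : (kernel.ι (factorThruImage (f ≫ S.g)) ≫ f) ≫ S.g = 0 := by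
    have := kernel.condition_assoc (factorThruImage (f ≫ S.g)) (image.ι (f ≫ S.g))
    rwa [image.fac, zero_comp, ← Category.assoc] at this
  let τ₁ : S'.X₁ ⟶ S.X₁ := hS.exact.lift _ hz
  have hτ₁ : τ₁ ≫ S.f = kernel.ι (factorThruImage (f ≫ S.g)) ≫ f := hS.exact.lift_f _ hz
  have : Mono τ₁ := by
    have : Mono (τ₁ ≫ S.f) := by rw [hτ₁]; infer_instance
    exact mono_of_mono τ₁ S.f
  let φ : S' ⟶ S := ⟨τ₁, f, image.ι (f ≫ S.g), hτ₁, (image.fac (f ≫ S.g)).symm⟩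
  have hk' : Mono (τ₁ ≫ k) := inferInstance
  have hq' : Mono (image.ι (f ≫ S.g) ≫ q) := inferInstance
  by_cases h₁ : IsIso (τ₁ ≫ k)
  · by_cases h₃ : IsIso (image.ι (f ≫ S.g) ≫ q)
    · exact absurd (ShortComplex.isIso₂_of_shortExact_of_isIso₁₃' φ hS' hS
        (isIso_of_mono_comp_isIso _ _ h₁).1 (isIso_of_mono_comp_isIso _ _ h₃).1) hf'
    · exact ihQ _ ⟨_, hq', h₃⟩ hS' (τ₁ ≫ k) (𝟙 _) hk' inferInstance
  · exact ihK _ ⟨_, hk', h₁⟩ ⟨_, hQ⟩ hS' (𝟙 _) (image.ι (f ≫ S.g) ≫ q) inferInstance hq'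

lemma acc_properSub_of_shortExact {S : ShortComplex C} (hS : S.ShortExact)
    (h₁ : Acc ProperSub S.X₁) (h₃ : Acc ProperSub S.X₃) : Acc ProperSub S.X₂ :=
  acc_properSub_of_shortExact_aux h₁ h₃ hS (𝟙 _) (𝟙 _) inferInstance inferInstance

lemma properSub_op_iff {X Y : Cᵒᵖ} : ProperSub X Y ↔ ProperQuot X.unop Y.unop :=
  ⟨fun ⟨f, _, h'⟩ => ⟨f.unop, inferInstance, by rwa [isIso_unop_iff]⟩,
    fun ⟨f, _, h'⟩ => ⟨f.op, inferInstance, by rwa [isIso_op_iff]⟩⟩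

lemma properQuot_op_iff {X Y : Cᵒᵖ} : ProperQuot X Y ↔ ProperSub X.unop Y.unop :=
  ⟨fun ⟨f, _, h'⟩ => ⟨f.unop, inferInstance, by rwa [isIso_unop_iff]⟩,
    fun ⟨f, _, h'⟩ => ⟨f.op, inferInstance, by rwa [isIso_op_iff]⟩⟩

lemma acc_properSub_op_iff (X : Cᵒᵖ) : Acc ProperSub X ↔ Acc ProperQuot X.unop := by
  constructor
  · intro h
    induction h with
    | intro X h ih =>
    exact ⟨_, fun Y hY => ih (Opposite.op Y) (properSub_op_iff.2 hY)⟩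
  · intro h
    obtain ⟨X⟩ := X
    change Acc ProperQuot X at h
    induction h with
    | intro X h ih =>
    exact ⟨_, fun Y hY => ih Y.unop (properSub_op_iff.1 hY)⟩

lemma acc_properQuot_of_shortExact {S : ShortComplex C} (hS : S.ShortExact)
    (h₁ : Acc ProperQuot S.X₁) (h₃ : Acc ProperQuot S.X₃) : Acc ProperQuot S.X₂ :=
  (acc_properSub_op_iff (Opposite.op S.X₂)).1 (acc_properSub_of_shortExact hS.op
    ((acc_properSub_op_iff (Opposite.op S.X₃)).2 h₃)
    ((acc_properSub_op_iff (Opposite.op S.X₁)).2 h₁))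

lemma acc_properSub_of_iso {X Y : C} (e : X ≅ Y) (h : Acc ProperSub X) : Acc ProperSub Y :=
  ⟨_, fun _ ⟨f, _, h'⟩ => h.inv ⟨f ≫ e.inv, inferInstance, fun h'' =>
    h' (isIso_of_mono_comp_isIso f e.inv h'').1⟩⟩

lemma acc_properQuot_of_iso {X Y : C} (e : X ≅ Y) (h : Acc ProperQuot X) : Acc ProperQuot Y :=
  ⟨_, fun _ ⟨f, _, h'⟩ => h.inv ⟨e.hom ≫ f, inferInstance, fun _ =>
    h' (IsIso.of_isIso_comp_left e.hom f)⟩⟩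

lemma acc_properSub_of_isZero {X : C} (h : IsZero X) : Acc ProperSub X := by
  refine ⟨_, fun Y => ?_⟩
  rintro ⟨f, hf, hf'⟩
  have : Epi f := ⟨fun _ _ _ => h.eq_of_src _ _⟩
  exact absurd (isIso_of_mono_of_epi f) hf'

lemma acc_properQuot_of_isZero {X : C} (h : IsZero X) : Acc ProperQuot X := by
  refine ⟨_, fun Y => ?_⟩
  rintro ⟨f, hf, hf'⟩
  have : Mono f := ⟨fun _ _ _ => h.eq_of_tgt _ _⟩
  exact absurd (isIso_of_mono_of_epi f) hf'

lemma acc_properSub_of_simple (X : C) [Simple X] : Acc ProperSub X := by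
  refine ⟨_, fun Y => ?_⟩
  rintro ⟨f, hf, hf'⟩
  refine acc_properSub_of_isZero ?_
  by_contra h
  refine hf' (isIso_of_mono_of_nonzero (f := f) fun h0 => h ?_)
  rw [IsZero.iff_id_eq_zero, ← cancel_mono f, h0, comp_zero, comp_zero]

lemma acc_properQuot_of_simple (X : C) [Simple X] : Acc ProperQuot X := by
  refine ⟨_, fun Y => ?_⟩
  rintro ⟨f, hf, hf'⟩
  refine acc_properQuot_of_isZero ?_
  by_contra h
  refine hf' (isIso_of_epi_of_nonzero (f := f) fun h0 => h ?_)
  rw [IsZero.iff_id_eq_zero, ← cancel_epi f, h0, zero_comp, zero_comp]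

lemma HasCompositionSeries.induction {P : C → Prop} (hiso : ∀ {X Y : C}, (X ≅ Y) → P X → P Y)
    (hzero : ∀ {X : C}, IsZero X → P X) (hsimple : ∀ (X : C) [Simple X], P X)
    (hext : ∀ {S : ShortComplex C}, S.ShortExact → P S.X₁ → P S.X₃ → P S.X₂)
    {X : C} (hX : HasCompositionSeries X) : P X := by
  obtain ⟨n, F, hF, h0, hn, h⟩ := hX
  have key : ∀ i ≤ n, P (F i : C) := by
    intro i
    induction i with
    | zero =>
      intro _
      rw [h0]
      exact hzero ((isZero_zero C).of_iso Subobject.botCoeIsoZero)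
    | succ i ih =>
      intro hi
      have := h i (by omega)
      exact hext (shortExact_cokernel ((F i).ofLE (F (i + 1)) (hF i))) (ih (by omega))
        (hsimple (cokernel ((F i).ofLE (F (i + 1)) (hF i))))
  have := key n le_rfl
  rw [hn] at this
  exact hiso (asIso (⊤ : Subobject X).arrow) this

variable (C) in
/-- Both chain conditions, expressed through objects only. -/
class FiniteLength : Prop where
  wf_properSub : WellFounded (ProperSub (C := C))
  wf_properQuot : WellFounded (ProperQuot (C := C))

lemma IsLengthCategory.finiteLength (hC : IsLengthCategory C) : FiniteLength C where
  wf_properSub := ⟨fun X => (hC X).induction acc_properSub_of_iso acc_properSub_of_isZero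
    (fun X _ => acc_properSub_of_simple X) acc_properSub_of_shortExact⟩
  wf_properQuot := ⟨fun X => (hC X).induction acc_properQuot_of_iso acc_properQuot_of_isZero
    (fun X _ => acc_properQuot_of_simple X) acc_properQuot_of_shortExact⟩

instance [FiniteLength C] : FiniteLength Cᵒᵖ where
  wf_properSub := ⟨fun X =>
    (acc_properSub_op_iff X).2 (FiniteLength.wf_properQuot.apply X.unop)⟩
  wf_properQuot := Subrelation.wf (fun h => properQuot_op_iff.1 h)
    (InvImage.wf Opposite.unop FiniteLength.wf_properSub)

theorem properSub_induction [FiniteLength C] {P : C → Prop}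
    (h : ∀ X, (∀ (Y : C) (f : Y ⟶ X), Mono f → ¬ IsIso f → P Y) → P X) (X : C) : P X :=
  FiniteLength.wf_properSub.induction X fun X ih => h X fun Y f hf hf' => ih Y ⟨f, hf, hf'⟩

theorem properQuot_induction [FiniteLength C] {P : C → Prop}
    (h : ∀ X, (∀ (Y : C) (f : X ⟶ Y), Epi f → ¬ IsIso f → P Y) → P X) (X : C) : P X :=
  FiniteLength.wf_properQuot.induction X fun X ih => h X fun Y f hf hf' => ih Y ⟨f, hf, hf'⟩

lemma isIso_of_mono_endo [FiniteLength C] {X : C} (f : X ⟶ X) [Mono f] : IsIso f := by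
  by_contra h
  exact (FiniteLength.wf_properSub (C := C)).irrefl.irrefl X ⟨f, inferInstance, h⟩

lemma not_isIso_cokernel_π {X Y : C} {i : X ⟶ Y} (hi : i ≠ 0) : ¬ IsIso (cokernel.π i) :=
  fun _ => hi (by rw [← cancel_mono (cokernel.π i), cokernel.condition, zero_comp])

end FiniteLength

/-! ### Torsion pairs and complete semidistributivity -/

section Torsion

variable {C : Type u} [Category.{v} C] [Abelian C]

lemma isZero_of_id_eq_zero {X : C} (h : 𝟙 X = 0) : IsZero X := (IsZero.iff_id_eq_zero X).2 h

lemma not_isIso_comp {X Y Z : C} {f : X ⟶ Y} [Epi f] (hf : ¬ IsIso f) (g : Y ⟶ Z) :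
    ¬ IsIso (f ≫ g) := fun _ => by
  have : Mono f := mono_of_mono f g
  exact hf (isIso_of_mono_of_epi f)

lemma not_isIso_comp' {X Y Z : C} (f : X ⟶ Y) {g : Y ⟶ Z} [Mono g] (hg : ¬ IsIso g) :
    ¬ IsIso (f ≫ g) := fun h => hg (isIso_of_mono_comp_isIso f g h).2

lemma image_ι_ne_zero {X Y : C} {f : X ⟶ Y} (hf : f ≠ 0) : image.ι f ≠ 0 :=
  fun h => hf (by rw [← image.fac f, h, comp_zero])

lemma not_isZero_image {X Y : C} {f : X ⟶ Y} (hf : f ≠ 0) : ¬ IsZero (image f) :=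
  fun h => image_ι_ne_zero hf (h.eq_of_src _ _)

lemma prop_of_prop_kernel {P : ObjectProperty C} (hP : P.IsClosedUnderExtensions) {X Y : C}
    (p : X ⟶ Y) [Epi p] (h₁ : P (kernel p)) (h₂ : P Y) : P X :=
  P.prop_X₂_of_shortExact (shortExact_kernel p) h₁ h₂

lemma prop_of_prop_cokernel {P : ObjectProperty C} (hP : P.IsClosedUnderExtensions) {X Y : C}
    (i : X ⟶ Y) [Mono i] (h₁ : P X) (h₂ : P (cokernel i)) : P Y :=
  P.prop_X₂_of_shortExact (shortExact_cokernel i) h₁ h₂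

/-- The kernel of a composition of epimorphisms is an extension of the kernels. -/
lemma prop_kernel_comp {P : ObjectProperty C} (hP : P.IsClosedUnderExtensions) {X Y Z : C}
    (p : X ⟶ Y) (q : Y ⟶ Z) [Epi p] (h₁ : P (kernel p)) (h₂ : P (kernel q)) :
    P (kernel (p ≫ q)) := by
  let a : kernel p ⟶ kernel (p ≫ q) :=
    kernel.lift _ (kernel.ι p) (by rw [kernel.condition_assoc, zero_comp])
  let b : kernel (p ≫ q) ⟶ kernel q :=
    kernel.lift _ (kernel.ι (p ≫ q) ≫ p) (by rw [Category.assoc, kernel.condition])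
  have ha : a ≫ kernel.ι (p ≫ q) = kernel.ι p := kernel.lift_ι _ _ _
  have hb : b ≫ kernel.ι q = kernel.ι (p ≫ q) ≫ p := kernel.lift_ι _ _ _
  have hab : a ≫ b = 0 := by
    rw [← cancel_mono (kernel.ι q), Category.assoc, hb, reassoc_of% ha, kernel.condition,
      zero_comp]
  have : Mono a := by
    have : Mono (a ≫ kernel.ι (p ≫ q)) := by rw [ha]; infer_instance
    exact mono_of_mono a (kernel.ι (p ≫ q))
  have : Epi b := by
    rw [epi_iff_surjective_up_to_refinements]
    intro A y
    obtain ⟨A', π, hπ, x, hx⟩ := surjective_up_to_refinements_of_epi p (y ≫ kernel.ι q)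
    refine ⟨A', π, hπ, kernel.lift _ x ?_, ?_⟩
    · rw [← Category.assoc, ← hx, Category.assoc, Category.assoc, kernel.condition, comp_zero,
        comp_zero]
    · rw [← cancel_mono (kernel.ι q), Category.assoc, Category.assoc, hb, kernel.lift_ι_assoc, hx]
  refine P.prop_X₂_of_shortExact (S := ShortComplex.mk a b hab) { exact := ?_ } h₁ h₂
  rw [ShortComplex.exact_iff_exact_up_to_refinements]
  intro A x hx
  dsimp at x hx
  refine ⟨A, 𝟙 A, inferInstance, kernel.lift _ (x ≫ kernel.ι _) ?_, ?_⟩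
  · rw [Category.assoc, ← hb, reassoc_of% hx, zero_comp]
  · dsimp
    rw [← cancel_mono (kernel.ι (p ≫ q)), Category.assoc, Category.assoc, ha, kernel.lift_ι,
      Category.id_comp]

lemma isZero_of_rightOrthogonal {P : ObjectProperty C} {X : C} (h : P X)
    (h' : P.rightOrthogonal X) : IsZero X :=
  isZero_of_id_eq_zero (h' (𝟙 X) h)

namespace IsTorsionClass

variable {P : ObjectProperty C} (hP : IsTorsionClass P)

include hP

lemma of_epi {X Y : C} (f : X ⟶ Y) [Epi f] (h : P X) : P Y :=
  have := hP.quotients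
  P.prop_of_epi f h

lemma of_isZero {X : C} (h : IsZero X) : P X :=
  have := hP.quotients
  have := hP.containsZero
  P.prop_of_isZero h

lemma of_image {X Y : C} (f : X ⟶ Y) (h : P X) : P (image f) :=
  hP.of_epi (factorThruImage f) h

/-- The torsion-free quotient of an object. -/
lemma exists_epi_rightOrthogonal [FiniteLength C] (X : C) :
    ∃ (Y : C) (p : X ⟶ Y), Epi p ∧ P (kernel p) ∧ P.rightOrthogonal Y := by
  induction X using properQuot_induction with
  | h X ih =>
  by_cases hX : P.rightOrthogonal X
  · exact ⟨X, 𝟙 X, inferInstance, hP.of_isZero (isZero_kernel_of_mono _), hX⟩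
  · obtain ⟨U, f, hU, hf⟩ : ∃ (U : C) (f : U ⟶ X), P U ∧ f ≠ 0 := by
      simpa [ObjectProperty.rightOrthogonal_iff] using hX
    -- Divide out a nonzero torsion subobject and continue with the smaller quotient.
    obtain ⟨Y, p, _, hk, hY⟩ := ih _ (cokernel.π (image.ι f)) inferInstance
      (not_isIso_cokernel_π (image_ι_ne_zero hf))
    refine ⟨Y, cokernel.π (image.ι f) ≫ p, epi_comp _ _,
      prop_kernel_comp hP.extensions _ _ ?_ hk, hY⟩
    exact hP.of_epi ((Abelian.monoIsKernelOfCokernel _ (colimit.isColimit _)).conePointUniqueUpToIso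
      (kernelIsKernel (cokernel.π (image.ι f)))).hom (hP.of_image f hU)

lemma of_leftOrthogonal_rightOrthogonal [FiniteLength C] {X : C}
    (h : P.rightOrthogonal.leftOrthogonal X) : P X := by
  obtain ⟨Y, p, _, hk, hY⟩ := hP.exists_epi_rightOrthogonal X
  refine prop_of_prop_kernel hP.extensions p hk (hP.of_isZero ?_)
  rw [IsZero.iff_id_eq_zero, ← cancel_epi p, h p hY, zero_comp, zero_comp]

end IsTorsionClass

lemma isTorsionClass_leftOrthogonal (P : ObjectProperty C) : IsTorsionClass P.leftOrthogonal where
  containsZero := inferInstance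
  quotients := ⟨fun f _ h _ g hY => by rw [← cancel_epi f, h (f ≫ g) hY, comp_zero]⟩
  extensions := ⟨fun {S} hS h₁ h₃ Y g hY => by
    have := hS.epi_g
    have hg : S.f ≫ g = 0 := h₁ (S.f ≫ g) hY
    rw [← hS.exact.g_desc g hg, h₃ (hS.exact.desc g hg) hY, comp_zero]⟩

lemma rightOrthogonal_of_mono {P : ObjectProperty C} {X Y : C} (f : X ⟶ Y) [Mono f]
    (h : P.rightOrthogonal Y) : P.rightOrthogonal X := fun _ g hg => by
  rw [← cancel_mono f, h (g ≫ f) hg, zero_comp]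

lemma rightOrthogonal_isClosedUnderExtensions (P : ObjectProperty C) :
    P.rightOrthogonal.IsClosedUnderExtensions := ⟨fun {S} hS h₁ h₃ Y g hY => by
  have := hS.mono_f
  have hg : g ≫ S.g = 0 := h₃ (g ≫ S.g) hY
  rw [← hS.exact.lift_f g hg, h₁ (hS.exact.lift g hg) hY, zero_comp]⟩

lemma rightOrthogonal_of_isZero (P : ObjectProperty C) {X : C} (h : IsZero X) :
    P.rightOrthogonal X := fun _ _ _ => h.eq_of_tgt _ _

/-- The torsion class of objects without nonzero morphisms to objects of `P`. -/
def leftTors (P : ObjectProperty C) : Tors C := ⟨P.leftOrthogonal, isTorsionClass_leftOrthogonal P⟩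

lemma tors_le_iff {a b : Tors C} : a ≤ b ↔ ∀ X, a.1 X → b.1 X := Iff.rfl

lemma tors_sInf_iff {𝒳 : Set (Tors C)} {X : C} : (sInf 𝒳).1 X ↔ ∀ a ∈ 𝒳, a.1 X := Iff.rfl

lemma tors_inf_iff {a b : Tors C} {X : C} : (a ⊓ b).1 X ↔ a.1 X ∧ b.1 X := by
  constructor
  · exact fun h => ⟨tors_le_iff.1 inf_le_left X h, tors_le_iff.1 inf_le_right X h⟩
  · intro h
    rw [← sInf_pair, tors_sInf_iff]
    rintro _ (rfl | rfl)
    exacts [h.1, h.2]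

lemma tors_sSup_rightOrthogonal_iff {𝒳 : Set (Tors C)} {Y : C} :
    (sSup 𝒳).1.rightOrthogonal Y ↔ ∀ a ∈ 𝒳, a.1.rightOrthogonal Y := by
  constructor
  · exact fun h a ha X f hX => h f (le_sSup (a := a) ha X hX)
  · intro h X f hX
    have : sSup 𝒳 ≤ leftTors (ObjectProperty.singleton Y) := sSup_le fun a ha U hU Z g hZ => by
      obtain rfl := ObjectProperty.singleton_iff _ _ |>.1 hZ
      exact h a ha g hU
    exact this X hX f (by simp)

lemma tors_sup_rightOrthogonal_iff {a b : Tors C} {Y : C} :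
    (a ⊔ b).1.rightOrthogonal Y ↔ a.1.rightOrthogonal Y ∧ b.1.rightOrthogonal Y := by
  rw [← sSup_pair, tors_sSup_rightOrthogonal_iff]
  simp

lemma torsClosure_le_iff {P : ObjectProperty C} {a : Tors C} : torsClosure P ≤ a ↔ P ≤ a.1 :=
  ⟨fun h X hX => h X fun _ hT => hT X hX, fun h => sInf_le h⟩

lemma le_torsClosure (P : ObjectProperty C) : P ≤ (torsClosure P).1 :=
  torsClosure_le_iff.1 le_rfl

lemma torsClosure_eq [FiniteLength C] (P : ObjectProperty C) :
    torsClosure P = leftTors P.rightOrthogonal := by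
  refine le_antisymm (torsClosure_le_iff.2 fun X hX Y f hY => hY f hX) fun X hX => ?_
  exact (torsClosure P).2.of_leftOrthogonal_rightOrthogonal fun Y f hY =>
    hX f fun Z g hZ => hY g (le_torsClosure P Z hZ)

lemma torsClosure_iff [FiniteLength C] {P : ObjectProperty C} {X : C} :
    (torsClosure P).1 X ↔ P.rightOrthogonal.leftOrthogonal X := by
  rw [torsClosure_eq]; rfl

lemma exists_not_isZero_of_not_le [FiniteLength C] {a b : Tors C} (h : ¬ a ≤ b) :
    ∃ X, a.1 X ∧ b.1.rightOrthogonal X ∧ ¬ IsZero X := by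
  obtain ⟨X, hX, hX'⟩ : ∃ X, a.1 X ∧ ¬ b.1 X := by simpa [tors_le_iff] using h
  obtain ⟨Y, p, _, hk, hY⟩ := b.2.exists_epi_rightOrthogonal X
  exact ⟨Y, a.2.of_epi p hX, hY, fun hY =>
    hX' (prop_of_prop_kernel b.2.extensions p hk (b.2.of_isZero hY))⟩

/-- If `a` is not contained in `b`, then `a ∩ b^⊥` has a nonzero object all of whose proper
quotients are in `b`. -/
lemma exists_properQuot_mem_of_not_le [FiniteLength C] {a b : Tors C} (h : ¬ a ≤ b) :
    ∃ X, a.1 X ∧ b.1.rightOrthogonal X ∧ ¬ IsZero X ∧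
      ∀ (Y : C) (f : X ⟶ Y), Epi f → ¬ IsIso f → b.1 Y := by
  obtain ⟨X, hX⟩ := exists_not_isZero_of_not_le h
  induction X using properQuot_induction with
  | h X ih =>
  by_cases hq : ∀ (Y : C) (f : X ⟶ Y), Epi f → ¬ IsIso f → b.1 Y
  · exact ⟨X, hX.1, hX.2.1, hX.2.2, hq⟩
  · push Not at hq
    obtain ⟨Y, f, _, hf, hY⟩ := hq
    obtain ⟨Z, p, _, hk, hZ⟩ := b.2.exists_epi_rightOrthogonal Y
    refine ih Z (f ≫ p) (epi_comp _ _) (not_isIso_comp hf p)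
      ⟨a.2.of_epi (f ≫ p) hX.1, hZ, fun hZ =>
        hY (prop_of_prop_kernel b.2.extensions p hk (b.2.of_isZero hZ))⟩

/-- The dual of `exists_properQuot_mem_of_not_le`. -/
lemma exists_properSub_mem_of_not_le [FiniteLength C] {a b : Tors C} (h : ¬ a ≤ b) :
    ∃ X, a.1 X ∧ b.1.rightOrthogonal X ∧ ¬ IsZero X ∧
      ∀ (Y : C) (f : Y ⟶ X), Mono f → ¬ IsIso f → a.1.rightOrthogonal Y := by
  obtain ⟨X, hX⟩ := exists_not_isZero_of_not_le h
  induction X using properSub_induction with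
  | h X ih =>
  by_cases hq : ∀ (Y : C) (f : Y ⟶ X), Mono f → ¬ IsIso f → a.1.rightOrthogonal Y
  · exact ⟨X, hX.1, hX.2.1, hX.2.2, hq⟩
  · push Not at hq
    obtain ⟨Y, f, _, hf, hY⟩ := hq
    obtain ⟨U, g, hU, hg⟩ : ∃ (U : C) (g : U ⟶ Y), a.1 U ∧ g ≠ 0 := by
      simpa [ObjectProperty.rightOrthogonal_iff] using hY
    exact ih (image g) (image.ι g ≫ f) (mono_comp _ _) (not_isIso_comp' _ hf)
      ⟨a.2.of_image g hU, rightOrthogonal_of_mono (image.ι g ≫ f) hX.2.1, not_isZero_image hg⟩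

/-- For joins, the proper subobjects of the witness `Z` in `b` are torsion-free for `b`, so for each
`x ≤ b` the `x`-torsion part of `Z` is zero or everything. Some `x` does not contain `Z`; then `Z`
is torsion-free for `a` and `x`, hence for `b`, which is absurd. For meets, the proper quotients of
`Z` lie in `b ≤ x`, so one nonzero map from `x` to `Z` forces `Z` into `x`. -/
theorem completelySemidistributive_tors [FiniteLength C] :
    CompletelySemidistributive (Tors C) where
  sup_sInf a b 𝒳 h𝒳 h := by
    obtain ⟨x₀, hx₀⟩ := h𝒳
    refine le_antisymm (sup_le (le_sup_left.trans (h x₀ hx₀).le)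
      ((sInf_le hx₀).trans (le_sup_right.trans (h x₀ hx₀).le))) ?_
    by_contra hle
    obtain ⟨Z, hZb, hZ, hZ0, hsub⟩ := exists_properSub_mem_of_not_le hle
    rw [tors_sup_rightOrthogonal_iff] at hZ
    obtain ⟨x, hx, hxZ⟩ : ∃ x ∈ 𝒳, ¬ x.1 Z := by
      by_contra! hcon
      exact hZ0 (isZero_of_rightOrthogonal hcon hZ.2)
    have hxb : x ≤ b := le_sup_right.trans (h x hx).le
    obtain ⟨Y, p, _, hk, hY⟩ := x.2.exists_epi_rightOrthogonal Z
    have hp : ¬ IsIso (kernel.ι p) := fun _ => hxZ (x.2.of_epi (kernel.ι p) hk)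
    have hk0 : IsZero (kernel p) :=
      isZero_of_rightOrthogonal (hxb _ hk) (hsub _ (kernel.ι p) inferInstance hp)
    have hZx : x.1.rightOrthogonal Z := prop_of_prop_kernel
      (rightOrthogonal_isClosedUnderExtensions _) p (rightOrthogonal_of_isZero _ hk0) hY
    refine hZ0 (isZero_of_rightOrthogonal hZb ?_)
    rw [← h x hx]
    exact tors_sup_rightOrthogonal_iff.2 ⟨hZ.1, hZx⟩
  inf_sSup a b 𝒳 h𝒳 h := by
    obtain ⟨x₀, hx₀⟩ := h𝒳
    refine le_antisymm ?_ (le_inf ((h x₀ hx₀).ge.trans inf_le_left)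
      (((h x₀ hx₀).ge.trans inf_le_right).trans (le_sSup hx₀)))
    by_contra hle
    obtain ⟨Z, hZ, hZb, hZ0, hquot⟩ := exists_properQuot_mem_of_not_le hle
    rw [tors_inf_iff] at hZ
    obtain ⟨x, hx, hxZ⟩ : ∃ x ∈ 𝒳, ¬ x.1.rightOrthogonal Z := by
      by_contra! hcon
      exact hZ0 (isZero_of_rightOrthogonal hZ.2 (tors_sSup_rightOrthogonal_iff.2 hcon))
    obtain ⟨U, g, hU, hg⟩ : ∃ (U : C) (g : U ⟶ Z), x.1 U ∧ g ≠ 0 := by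
      simpa [ObjectProperty.rightOrthogonal_iff] using hxZ
    have hbx : b ≤ x := (h x hx).ge.trans inf_le_right
    have hZx : x.1 Z := prop_of_prop_cokernel x.2.extensions (image.ι g) (x.2.of_image g hU)
      (hbx _ (hquot _ (cokernel.π (image.ι g)) inferInstance
        (not_isIso_cokernel_π (image_ι_ne_zero hg))))
    refine hZ0 (isZero_of_rightOrthogonal ?_ hZb)
    rw [← h x hx]
    exact tors_inf_iff.2 ⟨hZ.1, hZx⟩

end Torsion

/-! ### Semibricks generate wide subcategories -/

section Semibrick

variable {C : Type u} [Category.{v} C] [Abelian C]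

/-- The torsion class generated by `P`, in terms of orthogonals. -/
abbrev torsHull (P : ObjectProperty C) : ObjectProperty C := P.rightOrthogonal.leftOrthogonal

/-- The torsion-free class generated by `P`, in terms of orthogonals. -/
abbrev torfHull (P : ObjectProperty C) : ObjectProperty C := P.leftOrthogonal.rightOrthogonal

lemma torsHull_of_prop {P : ObjectProperty C} {X : C} (h : P X) : torsHull P X :=
  fun _ f hY => hY f h

lemma torfHull_of_prop {P : ObjectProperty C} {X : C} (h : P X) : torfHull P X :=
  fun _ f hY => hY f h

lemma torsHull_of_epi {P : ObjectProperty C} {X Y : C} (f : X ⟶ Y) [Epi f] (h : torsHull P X) :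
    torsHull P Y :=
  (isTorsionClass_leftOrthogonal _).of_epi f h

lemma exists_from_of_torsHull {P : ObjectProperty C} {X : C} (h : torsHull P X)
    (hX : ¬ IsZero X) : ∃ (s : C) (f : s ⟶ X), P s ∧ f ≠ 0 := by
  by_contra! hcon
  exact hX (isZero_of_id_eq_zero (h (𝟙 X) fun s f hs => hcon s f hs))

lemma exists_to_of_torfHull {P : ObjectProperty C} {X : C} (h : torfHull P X)
    (hX : ¬ IsZero X) : ∃ (s : C) (f : X ⟶ s), P s ∧ f ≠ 0 := by
  by_contra! hcon
  exact hX (isZero_of_id_eq_zero (h (𝟙 X) fun s f hs => hcon s f hs))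

lemma torfHull_op_iff {P : ObjectProperty C} {X : Cᵒᵖ} :
    torfHull P.op X ↔ torsHull P X.unop := by
  constructor
  · intro h Y f hY
    exact Quiver.Hom.op_inj (h f.op fun Z g hZ => Quiver.Hom.unop_inj (hY g.unop hZ))
  · intro h Y f hY
    exact Quiver.Hom.unop_inj (h f.unop fun Z g hZ => Quiver.Hom.op_inj (hY g.op hZ))

lemma torsHull_op_iff {P : ObjectProperty C} {X : Cᵒᵖ} :
    torsHull P.op X ↔ torfHull P X.unop := by
  constructor
  · intro h Y f hY
    exact Quiver.Hom.op_inj (h f.op fun Z g hZ => Quiver.Hom.unop_inj (hY g.unop hZ))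
  · intro h Y f hY
    exact Quiver.Hom.unop_inj (h f.unop fun Z g hZ => Quiver.Hom.op_inj (hY g.op hZ))

/-- Semibricks: nonzero objects between which every nonzero morphism is an isomorphism. -/
structure IsSemibrick (S : ObjectProperty C) : Prop where
  not_isZero : ∀ X, S X → ¬ IsZero X
  isIso : ∀ {X Y : C} (f : X ⟶ Y), S X → S Y → f ≠ 0 → IsIso f

/-- A retraction `r` of a monomorphism `i` splits the epimorphism `p`, by a section killed
by `r`. -/
lemma exists_section {X Y Z : C} {i : X ⟶ Y} {p : Y ⟶ Z} {w : i ≫ p = 0}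
    (h : (ShortComplex.mk i p w).ShortExact) (r : Y ⟶ X) (hr : i ≫ r = 𝟙 X) :
    ∃ σ : Z ⟶ Y, σ ≫ p = 𝟙 Z ∧ σ ≫ r = 0 :=
  let e := ShortComplex.Splitting.ofExactOfRetraction _ h.exact r hr h.epi_g
  ⟨e.s, e.s_g, e.s_r⟩

/-- The pullback of a short exact sequence. -/
lemma exists_pullback_shortExact {X Y U : C} (i : X ⟶ Y) [Mono i] (h : U ⟶ cokernel i) :
    ∃ (V : C) (j : X ⟶ V) (p : V ⟶ U) (g : V ⟶ Y) (w : j ≫ p = 0),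
      (ShortComplex.mk j p w).ShortExact ∧ j ≫ g = i ∧ p ≫ h = g ≫ cokernel.π i := by
  let j : X ⟶ pullback h (cokernel.π i) :=
    pullback.lift 0 i (by rw [zero_comp, cokernel.condition])
  have hj₁ : j ≫ pullback.fst h (cokernel.π i) = 0 := pullback.lift_fst _ _ _
  have hj₂ : j ≫ pullback.snd h (cokernel.π i) = i := pullback.lift_snd _ _ _
  have : Mono j := by
    have : Mono (j ≫ pullback.snd h (cokernel.π i)) := by rw [hj₂]; infer_instance
    exact mono_of_mono j (pullback.snd h (cokernel.π i))
  refine ⟨_, j, pullback.fst _ _, pullback.snd _ _, hj₁, { exact := ?_ }, hj₂,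
    pullback.condition⟩
  rw [ShortComplex.exact_iff_exact_up_to_refinements]
  intro A x hx
  dsimp at x hx
  obtain ⟨A', π, hπ, y, hy⟩ := (ShortComplex.exact_cokernel i).exact_up_to_refinements
    (x ≫ pullback.snd h (cokernel.π i))
    (by dsimp; rw [Category.assoc, ← pullback.condition, reassoc_of% hx, zero_comp])
  dsimp at y hy
  refine ⟨A', π, hπ, y, ?_⟩
  dsimp
  apply pullback.hom_ext
  · rw [Category.assoc, Category.assoc, hx, hj₁, comp_zero, comp_zero]
  · rw [Category.assoc, Category.assoc, hj₂, hy]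

lemma shortExact_left_eq_desc {X Y Z W : C} {i : X ⟶ Y} {p : Y ⟶ Z} {w : i ≫ p = 0}
    (h : (ShortComplex.mk i p w).ShortExact) (f : Y ⟶ W) (hf : i ≫ f = 0) :
    ∃ g : Z ⟶ W, p ≫ g = f :=
  have := h.epi_g
  ⟨h.exact.desc f hf, h.exact.g_desc f hf⟩

namespace IsSemibrick

variable {S : ObjectProperty C} (hS : IsSemibrick S)

include hS

lemma op : IsSemibrick S.op where
  not_isZero X hX h := hS.not_isZero X.unop hX h.unop
  isIso f hX hY hf := by
    rw [← isIso_unop_iff]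
    exact hS.isIso f.unop hY hX fun h => hf (Quiver.Hom.unop_inj h)

/-- The image of `f` is torsion-free, so it maps nontrivially to some `t` in `S`; the composite `s ⟶
t` is then an isomorphism. -/
lemma mono_of_torfHull {s X : C} (f : s ⟶ X) (hs : S s) (hX : torfHull S X) (hf : f ≠ 0) :
    Mono f := by
  obtain ⟨t, g, ht, hg⟩ := exists_to_of_torfHull (rightOrthogonal_of_mono (image.ι f) hX)
    (not_isZero_image hf)
  have : IsIso (factorThruImage f ≫ g) := hS.isIso _ hs ht fun h =>
    hg (by rwa [← cancel_epi (factorThruImage f), comp_zero])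
  have : Mono (factorThruImage f) := mono_of_mono _ g
  rw [← image.fac f]
  infer_instance

lemma epi_of_torsHull {s X : C} (f : X ⟶ s) (hs : S s) (hX : torsHull S X) (hf : f ≠ 0) :
    Epi f := by
  obtain ⟨t, g, ht, hg⟩ := exists_from_of_torsHull (torsHull_of_epi (factorThruImage f) hX)
    (not_isZero_image hf)
  have : IsIso (g ≫ image.ι f) := hS.isIso _ ht hs fun h =>
    hg (by rwa [← cancel_mono (image.ι f), zero_comp])
  have : Epi (image.ι f) := epi_of_epi g _
  rw [← image.fac f]
  infer_instance

/-- Given `U` in ⊥S mapping to the cokernel, pull back to an extension `V` of `U` by `s`. As `V`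
maps nontrivially to `X`, it has a map to `S`, nonzero on `s` because `U` has none. That map splits
the extension, so `U` lifts to `X`, where it vanishes. -/
lemma torfHull_cokernel {s X : C} (i : s ⟶ X) [Mono i] (hs : S s) (hX : torfHull S X) :
    torfHull S (cokernel i) := by
  intro U h hU
  obtain ⟨V, j, p, g, w, hex, hjg, hph⟩ := exists_pullback_shortExact i h
  have := hex.epi_g
  have hg0 : g ≠ 0 := by
    rintro rfl
    refine hS.not_isZero s hs (isZero_of_id_eq_zero ?_)
    rw [← cancel_mono i, ← hjg, comp_zero, comp_zero, comp_zero]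
  obtain ⟨t, φ, ht, hφ⟩ : ∃ (t : C) (φ : V ⟶ t), S t ∧ j ≫ φ ≠ 0 := by
    by_contra! hcon
    refine hg0 (hX g fun t φ ht => ?_)
    obtain ⟨ψ, rfl⟩ := shortExact_left_eq_desc hex φ (hcon t φ ht)
    rw [hU ψ ht, comp_zero]
  have : IsIso (j ≫ φ) := hS.isIso _ hs ht hφ
  obtain ⟨σ, hσ, -⟩ := exists_section hex (φ ≫ inv (j ≫ φ))
    (by rw [← Category.assoc, IsIso.hom_inv_id])
  rw [← Category.id_comp h, ← hσ, Category.assoc, hph, ← Category.assoc, hX (σ ≫ g) hU, zero_comp]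

/-- A morphism from an object of `T(S)` to an object of `T(S) ∩ F(S)` is mono as soon as its
kernel is torsion-free. -/
lemma mono_of_cancel [FiniteLength C] {X : C} (hX : torsHull S X) {Y : C} (hY : torsHull S Y)
    (hY' : torfHull S Y) (f : X ⟶ Y)
    (hf : ∀ (U : C) (h : U ⟶ X), torsHull S U → h ≫ f = 0 → h = 0) : Mono f := by
  induction X using properQuot_induction generalizing Y with
  | h X ih =>
  by_cases hX0 : IsZero X
  · exact ⟨fun _ _ _ => hX0.eq_of_tgt _ _⟩
  obtain ⟨s, g, hs, hg⟩ := exists_from_of_torsHull hX hX0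
  have hgf : Mono (g ≫ f) := hS.mono_of_torfHull _ hs hY' fun h =>
    hg (hf s g (torsHull_of_prop hs) h)
  have hg' : Mono g := mono_of_mono g f
  -- Dividing `s` out of source and target preserves the hypotheses and shrinks the source.
  let f' : cokernel g ⟶ cokernel (g ≫ f) := cokernel.map _ _ (𝟙 s) f (by simp)
  have hf' : cokernel.π g ≫ f' = f ≫ cokernel.π (g ≫ f) := cokernel.π_desc _ _ _
  have : Mono f' := by
    refine ih _ (cokernel.π g) inferInstance (not_isIso_cokernel_π hg)
      (torsHull_of_epi (cokernel.π g) hX) (torsHull_of_epi (cokernel.π (g ≫ f)) hY)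
      (hS.torfHull_cokernel (g ≫ f) hs hY') f' fun U h hU hhf => ?_
    -- Since `k ≫ f` lands in `s`, it retracts the extension `V`; along the resulting section, `k`
    -- becomes a map from `U` killed by `f`, hence zero.
    obtain ⟨V, j, p, k, w, hex, hjk, hph⟩ := exists_pullback_shortExact g h
    have hk : (k ≫ f) ≫ cokernel.π (g ≫ f) = 0 := by
      rw [Category.assoc, ← hf', ← Category.assoc, ← hph, Category.assoc, hhf, comp_zero]
    let r : V ⟶ s := (ShortComplex.exact_cokernel (g ≫ f)).lift (k ≫ f) hk
    have hr : r ≫ g ≫ f = k ≫ f := (ShortComplex.exact_cokernel (g ≫ f)).lift_f (k ≫ f) hk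
    obtain ⟨σ, hσ, hσr⟩ := exists_section hex r (by
      rw [← cancel_mono (g ≫ f), Category.assoc, hr, ← Category.assoc, hjk, Category.id_comp])
    have hσk : σ ≫ k = 0 := hf U _ hU (by
      rw [Category.assoc, ← hr, ← Category.assoc, hσr, zero_comp])
    rw [← Category.id_comp h, ← hσ, Category.assoc, hph, ← Category.assoc, hσk, zero_comp]
  refine Preadditive.mono_of_cancel_zero f fun {A} a ha => ?_
  have ha' : a ≫ cokernel.π g = 0 := by
    rw [← cancel_mono f', Category.assoc, hf', ← Category.assoc, ha, zero_comp, zero_comp]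
  have hlift := (ShortComplex.exact_cokernel g).lift_f a ha'
  dsimp at hlift
  rw [← hlift, Category.assoc] at ha
  rw [← hlift, zero_of_comp_mono (g ≫ f) ha, zero_comp]

/-- Once the torsion part of the kernel is divided out of `X`, the induced map to `Y` is mono by
`mono_of_cancel`. So the kernel equals its torsion part. -/
lemma torsHull_kernel [FiniteLength C] {X Y : C} (hX : torsHull S X) (hY : torsHull S Y)
    (hY' : torfHull S Y) (f : X ⟶ Y) : torsHull S (kernel f) := by
  have hT : IsTorsionClass (torsHull S) := isTorsionClass_leftOrthogonal _
  obtain ⟨Q, p, _, hk, hQ⟩ := hT.exists_epi_rightOrthogonal (kernel f)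
  let i : kernel p ⟶ X := kernel.ι p ≫ kernel.ι f
  let f' : cokernel i ⟶ Y := cokernel.desc i f (by simp [i])
  have hf' : cokernel.π i ≫ f' = f := cokernel.π_desc _ _ _
  have : Mono f' := by
    refine hS.mono_of_cancel (torsHull_of_epi (cokernel.π i) hX) hY hY' f' fun U h hU hh => ?_
    obtain ⟨V, j, q, k, w, hex, hjk, hqh⟩ := exists_pullback_shortExact i h
    have := hex.epi_g
    have hkf : k ≫ f = 0 := by
      rw [← hf', ← Category.assoc, ← hqh, Category.assoc, hh, comp_zero]
    have hV : torsHull S V := hT.extensions.prop_X₂_of_shortExact hex hk hU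
    have hl : kernel.lift f k hkf ≫ p = 0 := hQ _ hV
    rw [← cancel_epi q, hqh, comp_zero]
    have hk' : kernel.lift p (kernel.lift f k hkf) hl ≫ i = k := by simp [i]
    rw [← hk', Category.assoc, cokernel.condition, comp_zero]
  have h0 : kernel.ι f ≫ cokernel.π i = 0 := by
    rw [← cancel_mono f', Category.assoc, hf', kernel.condition, zero_comp]
  let l : kernel f ⟶ kernel p := (ShortComplex.exact_cokernel i).lift _ h0
  have hl : l ≫ i = kernel.ι f := (ShortComplex.exact_cokernel i).lift_f _ h0
  have hlp : l ≫ kernel.ι p = 𝟙 _ := by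
    rw [← cancel_mono (kernel.ι f), Category.assoc, Category.id_comp]
    exact hl
  have : Epi (kernel.ι p) := by
    have : Epi (l ≫ kernel.ι p) := by rw [hlp]; infer_instance
    exact epi_of_epi l _
  exact hT.of_epi (kernel.ι p) hk

/-- Dual of `torsHull_kernel`: passing to the opposite category exchanges the two hulls. -/
lemma torfHull_cokernel' [FiniteLength C] {X Y : C} (hX : torsHull S X) (hX' : torfHull S X)
    (hY : torfHull S Y) (f : X ⟶ Y) : torfHull S (cokernel f) := by
  have h := hS.op.torsHull_kernel (X := Opposite.op Y) (Y := Opposite.op X)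
    (torsHull_op_iff.2 hY) (torsHull_op_iff.2 hX') (torfHull_op_iff.2 hX) f.op
  exact (torfHull S).prop_of_iso (kernelOpUnop f) (torsHull_op_iff.1 h)

/-- The wide subcategory generated by a semibrick. -/
lemma isWide [FiniteLength C] : IsWide (torsHull S ⊓ torfHull S) where
  containsZero := by
    obtain ⟨Z, hZ⟩ := HasZeroObject.zero (C := C)
    exact ⟨Z, hZ, (isTorsionClass_leftOrthogonal _).of_isZero hZ, rightOrthogonal_of_isZero _ hZ⟩
  extensions := ⟨fun hE h₁ h₃ =>
    ⟨(isTorsionClass_leftOrthogonal _).extensions.prop_X₂_of_shortExact hE h₁.1 h₃.1,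
      (rightOrthogonal_isClosedUnderExtensions _).prop_X₂_of_shortExact hE h₁.2 h₃.2⟩⟩
  kernels := ⟨by
    rintro _ ⟨f, k, hk, hX, hY⟩
    have h := hS.torsHull_kernel hX.1 hY.1 hY.2 f
    refine ⟨(torsHull S).prop_of_iso ((kernelIsKernel f).conePointUniqueUpToIso hk) h, ?_⟩
    have : Mono (Fork.ι k) := mono_of_isLimit_fork hk
    exact rightOrthogonal_of_mono (Fork.ι k) hX.2⟩
  cokernels := ⟨by
    rintro _ ⟨f, k, hk, hX, hY⟩
    have h := hS.torfHull_cokernel' hX.1 hX.2 hY.2 f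
    refine ⟨?_, (torfHull S).prop_of_iso
      ((cokernelIsCokernel f).coconePointUniqueUpToIso hk) h⟩
    have : Epi (Cofork.π k) := epi_of_isColimit_cofork hk
    exact torsHull_of_epi (Cofork.π k) hY.1⟩

/-- The quotient of `X` by its ⊥S-part lies in both hulls, so `torsHull_kernel` puts that part in
T(S) as well and `h` kills it. This is how F(S) is recognised from T(S) ∩ ⊥S alone. -/
lemma torfHull_of_cancel [FiniteLength C] {X : C} (hX : torsHull S X)
    (h : ∀ (U : C) (f : U ⟶ X), torsHull S U → S.leftOrthogonal U → f = 0) : torfHull S X := by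
  obtain ⟨Q, p, _, hk, hQ⟩ :=
    (isTorsionClass_leftOrthogonal S).exists_epi_rightOrthogonal X
  have h0 : kernel.ι p = 0 :=
    h _ _ (hS.torsHull_kernel hX (torsHull_of_epi p hX) hQ p) hk
  have : Mono p := Preadditive.mono_of_kernel_zero h0
  exact rightOrthogonal_of_mono p hQ

end IsSemibrick

/-! ### Wide subcategories and their simple objects -/

lemma IsWide.prop_kernel {W : ObjectProperty C} (hW : IsWide W) {X Y : C} (f : X ⟶ Y) (hX : W X)
    (hY : W Y) : W (kernel f) :=
  have := hW.kernels
  ObjectProperty.prop_kernel W f hX hY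

lemma IsWide.prop_cokernel {W : ObjectProperty C} (hW : IsWide W) {X Y : C} (f : X ⟶ Y) (hX : W X)
    (hY : W Y) : W (cokernel f) :=
  have := hW.cokernels
  ObjectProperty.prop_cokernel W f hX hY

/-- `e.inv` is a kernel of the zero endomorphism of `X`. -/
lemma IsWide.prop_of_iso {W : ObjectProperty C} (hW : IsWide W) {X Y : C} (e : X ≅ Y) (hX : W X) :
    W Y :=
  have := hW.kernels
  W.prop_of_isLimit_kernelFork (f := (0 : X ⟶ X)) (k := KernelFork.ofι e.inv (by simp))
    (KernelFork.IsLimit.ofι' _ _ fun k _ => ⟨k ≫ e.hom, by simp⟩) hX hX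

lemma IsWide.prop_of_isZero {W : ObjectProperty C} (hW : IsWide W) {X : C} (h : IsZero X) :
    W X := by
  obtain ⟨Z, hZ, hWZ⟩ := hW.containsZero
  exact hW.prop_of_iso (hZ.iso h) hWZ

lemma IsWide.prop_image {W : ObjectProperty C} (hW : IsWide W) {X Y : C} (f : X ⟶ Y) (hX : W X)
    (hY : W Y) : W (image f) :=
  hW.prop_of_iso (Abelian.imageIsoImage f) (hW.prop_kernel _ hY (hW.prop_cokernel f hX hY))

/-- The simple objects of a wide subcategory. -/
def wideSimples (W : ObjectProperty C) : ObjectProperty C := fun X =>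
  W X ∧ ¬ IsZero X ∧ (∀ (Y : C) (f : X ⟶ Y), W Y → f ≠ 0 → Mono f) ∧
    ∀ (Y : C) (f : Y ⟶ X), W Y → f ≠ 0 → Epi f

lemma isSemibrick_wideSimples (W : ObjectProperty C) : IsSemibrick (wideSimples W) where
  not_isZero _ hX := hX.2.1
  isIso f hX hY hf := by
    have := hX.2.2.1 _ f hY.1 hf
    have := hY.2.2.2 _ f hX.1 hf
    exact isIso_of_mono_of_epi f

namespace IsWide

variable [FiniteLength C] {W : ObjectProperty C} (hW : IsWide W)

include hW

/-- A nonzero object of `W` that is not simple in `W` has a smaller nonzero subobject in `W`, a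
kernel or an image. -/
lemma exists_mono_wideSimples {X : C} (hX : W X) (hX0 : ¬ IsZero X) :
    ∃ (s : C) (i : s ⟶ X), wideSimples W s ∧ Mono i := by
  induction X using properSub_induction with
  | h X ih =>
  have step : ∀ (Y : C) (f : Y ⟶ X), Mono f → W Y → ¬ IsZero Y → ¬ IsIso f →
      ∃ (s : C) (i : s ⟶ X), wideSimples W s ∧ Mono i := fun Y f hf hY hY0 hf' => by
    obtain ⟨s, i, hs, hi⟩ := ih Y f hf hf' hY hY0
    exact ⟨s, i ≫ f, hs, mono_comp _ _⟩
  by_cases h₁ : ∀ (Y : C) (f : X ⟶ Y), W Y → f ≠ 0 → Mono f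
  · by_cases h₂ : ∀ (Y : C) (f : Y ⟶ X), W Y → f ≠ 0 → Epi f
    · exact ⟨X, 𝟙 X, ⟨hX, hX0, h₁, h₂⟩, inferInstance⟩
    · push Not at h₂
      obtain ⟨Y, f, hY, hf, hf'⟩ := h₂
      refine step _ (image.ι f) inferInstance (hW.prop_image f hY hX) (not_isZero_image hf)
        fun _ => hf' ?_
      rw [← image.fac f]
      infer_instance
  · push Not at h₁
    obtain ⟨Y, f, hY, hf, hf'⟩ := h₁
    refine step _ (kernel.ι f) inferInstance (hW.prop_kernel f hX hY)
      (fun h => hf' (Preadditive.mono_of_kernel_zero (h.eq_of_src _ _))) fun _ => hf ?_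
    rw [← cancel_epi (kernel.ι f), kernel.condition, comp_zero]

lemma wide_induction {P : C → Prop} (hzero : ∀ X, IsZero X → P X)
    (hstep : ∀ (s X : C) (i : s ⟶ X) (_ : Mono i), wideSimples W s → W X → P (cokernel i) → P X)
    {X : C} (hX : W X) : P X := by
  induction X using properQuot_induction with
  | h X ih =>
  by_cases hX0 : IsZero X
  · exact hzero X hX0
  · obtain ⟨s, i, hs, hi⟩ := hW.exists_mono_wideSimples hX hX0
    exact hstep s X i hi hs hX (ih _ (cokernel.π i) inferInstance
      (not_isIso_cokernel_π fun h => hs.2.1 (isZero_of_id_eq_zero (by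
        rw [← cancel_mono i, h, comp_zero, comp_zero]))) (hW.prop_cokernel i hs.1 hX))

lemma torsHull_wideSimples_of_prop {X : C} (hX : W X) : torsHull (wideSimples W) X := by
  refine hW.wide_induction (fun X h => (isTorsionClass_leftOrthogonal _).of_isZero h)
    (fun s X i _ hs _ h => ?_) hX
  exact prop_of_prop_cokernel (isTorsionClass_leftOrthogonal _).extensions i
    (torsHull_of_prop hs) h

lemma torfHull_wideSimples_of_prop {X : C} (hX : W X) : torfHull (wideSimples W) X := by
  refine hW.wide_induction (fun X h => rightOrthogonal_of_isZero _ h)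
    (fun s X i _ hs _ h => ?_) hX
  exact prop_of_prop_cokernel (rightOrthogonal_isClosedUnderExtensions _) i
    (torfHull_of_prop hs) h

/-- Peel off simples: a nonzero map from one is mono, and its cokernel stays in both hulls. -/
lemma prop_of_hulls {X : C} (hX : torsHull (wideSimples W) X)
    (hX' : torfHull (wideSimples W) X) : W X := by
  have hS := isSemibrick_wideSimples W
  induction X using properQuot_induction with
  | h X ih =>
  by_cases hX0 : IsZero X
  · exact hW.prop_of_isZero hX0
  · obtain ⟨s, i, hs, hi⟩ := exists_from_of_torsHull hX hX0
    have := hS.mono_of_torfHull i hs hX' hi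
    exact prop_of_prop_cokernel hW.extensions i hs.1 (ih _ (cokernel.π i) inferInstance
      (not_isIso_cokernel_π hi) (torsHull_of_epi (cokernel.π i) hX)
      (hS.torfHull_cokernel i hs hX'))

lemma eq_hulls : torsHull (wideSimples W) ⊓ torfHull (wideSimples W) = W :=
  le_antisymm (fun _ hX => hW.prop_of_hulls hX.1 hX.2) fun _ hX =>
    ⟨hW.torsHull_wideSimples_of_prop hX, hW.torfHull_wideSimples_of_prop hX⟩

lemma torsClosure_wideSimples : torsClosure (wideSimples W) = torsClosure W := by
  refine le_antisymm (torsClosure_le_iff.2 fun X hX => le_torsClosure W X hX.1)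
    (torsClosure_le_iff.2 fun X hX => ?_)
  exact torsClosure_iff.2 (hW.torsHull_wideSimples_of_prop hX)

end IsWide

end Semibrick

/-! ### Canonical join representations in a complete lattice -/

section CanonicalJoin

lemma lowerStar_lt {L : Type*} [CompleteLattice L] {j : L} (hj : CompletelyJoinIrreducible j) :
    lowerStar j < j :=
  lt_of_le_of_ne (sSup_le fun _ hx => le_of_lt hx) fun h => lt_irrefl j (hj {x | x < j} h.symm)

/-- The members of a canonical join representation cannot be replaced by smaller joins. -/
lemma IsCanonicalJoinRep.mem_of_sSup_eq {L : Type*} [CompleteLattice L] {A : Set L} {x a : L}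
    (hA : IsCanonicalJoinRep A x) (ha : a ∈ A) (B : Set L) (hBa : ∀ b ∈ B, b ≤ a)
    (hB : a ≤ sSup (A \ {a} ∪ B)) : a ∈ B := by
  have hsup : sSup (A \ {a} ∪ B) = x := by
    refine le_antisymm (sSup_le ?_) ?_
    · rintro b (hb | hb)
      · exact hA.sSup_eq ▸ le_sSup hb.1
      · exact (hBa b hb).trans (hA.sSup_eq ▸ le_sSup ha)
    · rw [← hA.sSup_eq]
      refine sSup_le fun b hb => ?_
      by_cases hba : b = a
      · exact hba ▸ hB
      · exact le_sSup (Or.inl ⟨hb, hba⟩)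
  obtain ⟨b, hb, hab⟩ := hA.refines _ hsup a ha
  rcases hb with hb | hb
  · exact absurd (hA.antichain a ha b hb.1 hab).symm hb.2
  · exact le_antisymm hab (hBa b hb) ▸ hb

lemma IsCanonicalJoinRep.completelyJoinIrreducible {L : Type*} [CompleteLattice L] {A : Set L}
    {x a : L} (hA : IsCanonicalJoinRep A x) (ha : a ∈ A) : CompletelyJoinIrreducible a := by
  intro Y hY
  refine hA.mem_of_sSup_eq ha Y (fun b hb => hY ▸ le_sSup hb) ?_
  conv_lhs => rw [hY]
  exact sSup_le_sSup Set.subset_union_right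

end CanonicalJoin

/-! ### Bricks, join-irreducibles and kappa -/

section Brick

variable {C : Type u} [Category.{v} C] [Abelian C]

/-- Bricks: nonzero objects all of whose nonzero endomorphisms are isomorphisms. -/
structure IsBrick (B : C) : Prop where
  not_isZero : ¬ IsZero B
  isIso : ∀ f : B ⟶ B, f ≠ 0 → IsIso f

lemma IsSemibrick.isBrick {S : ObjectProperty C} (hS : IsSemibrick S) {B : C} (hB : S B) :
    IsBrick B :=
  ⟨hS.not_isZero B hB, fun f => hS.isIso f hB hB⟩

lemma IsBrick.isSemibrick {B : C} (hB : IsBrick B) : IsSemibrick (.singleton B) where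
  not_isZero X hX := by
    obtain rfl := (ObjectProperty.singleton_iff _ _).1 hX
    exact hB.not_isZero
  isIso f hX hY := by
    obtain rfl := (ObjectProperty.singleton_iff _ _).1 hX
    obtain rfl := (ObjectProperty.singleton_iff _ _).1 hY
    exact hB.isIso f

/-- The torsion class generated by an object. -/
def objTors (B : C) : Tors C := torsClosure (.singleton B)

lemma objTors_le_iff {B : C} {a : Tors C} : objTors B ≤ a ↔ a.1 B := by
  rw [objTors, torsClosure_le_iff, ObjectProperty.singleton_le_iff]

lemma objTors_self (B : C) : (objTors B).1 B := objTors_le_iff.1 le_rfl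

/-- The torsion class of objects without nonzero morphisms to `B`. -/
def objLeftTors (B : C) : Tors C := leftTors (.singleton B)

lemma objLeftTors_iff {B X : C} : (objLeftTors B).1 X ↔ ∀ f : X ⟶ B, f = 0 := by
  constructor
  · exact fun h f => h f (by simp)
  · intro h Y f hY
    obtain rfl := (ObjectProperty.singleton_iff _ _).1 hY
    exact h f

lemma leftTors_le_objLeftTors {S : ObjectProperty C} {B : C} (hB : S B) :
    leftTors S ≤ objLeftTors B :=
  fun _ hX => objLeftTors_iff.2 fun f => hX f hB

lemma not_objLeftTors_self {B : C} (hB : ¬ IsZero B) : ¬ (objLeftTors B).1 B :=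
  fun h => hB (isZero_of_id_eq_zero (objLeftTors_iff.1 h (𝟙 B)))

lemma sSup_objTors (S : ObjectProperty C) :
    sSup {j | ∃ B, S B ∧ objTors B = j} = torsClosure S := by
  refine le_antisymm (sSup_le ?_) (torsClosure_le_iff.2 fun B hB => ?_)
  · rintro _ ⟨B, hB, rfl⟩
    exact objTors_le_iff.2 (le_torsClosure S B hB)
  · exact objTors_le_iff.1 (le_sSup ⟨B, hB, rfl⟩)

variable [FiniteLength C]

/-- A nonzero map from an object of T(S) to `B` is epi, so it would put `B` in `b`. This dichotomy
yields both the canonical joins and the lower covers. -/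
lemma IsSemibrick.le_objLeftTors {S : ObjectProperty C} (hS : IsSemibrick S) {B : C} (hB : S B)
    {b : Tors C} (hb : b ≤ torsClosure S) (hbB : ¬ b.1 B) : b ≤ objLeftTors B := by
  intro X hX
  refine objLeftTors_iff.2 fun f => ?_
  by_contra hf
  have := hS.epi_of_torsHull f hB (torsClosure_iff.1 (hb X hX)) hf
  exact hbB (b.2.of_epi f hX)

namespace IsBrick

variable {B : C} (hB : IsBrick B)

include hB

lemma lt_objTors_iff {b : Tors C} : b < objTors B ↔ b ≤ objTors B ⊓ objLeftTors B := by
  constructor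
  · intro h
    refine le_inf h.le (hB.isSemibrick.le_objLeftTors (by simp) h.le fun hbB => ?_)
    exact h.not_ge (objTors_le_iff.2 hbB)
  · intro h
    refine lt_of_le_not_ge (h.trans inf_le_left) fun h' => not_objLeftTors_self hB.not_isZero ?_
    exact h.trans inf_le_right B (h' B (objTors_self B))

lemma lowerStar_eq : lowerStar (objTors B) = objTors B ⊓ objLeftTors B :=
  le_antisymm (sSup_le fun _ hx => hB.lt_objTors_iff.1 hx) (le_sSup (hB.lt_objTors_iff.2 le_rfl))

lemma completelyJoinIrreducible : CompletelyJoinIrreducible (objTors B) := by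
  intro X hX
  by_contra h
  refine lt_irrefl (objTors B) (hB.lt_objTors_iff.2 ?_)
  conv_lhs => rw [hX]
  refine sSup_le fun x hx => hB.lt_objTors_iff.1 (lt_of_le_of_ne ?_ ?_)
  · rw [hX]
    exact le_sSup hx
  · rintro rfl
    exact h hx

lemma properQuot_mem {Y : C} (f : B ⟶ Y) [Epi f] (hf : ¬ IsIso f) :
    (objTors B ⊓ objLeftTors B).1 Y := by
  refine tors_inf_iff.2 ⟨(objTors B).2.of_epi f (objTors_self B), objLeftTors_iff.2 fun g => ?_⟩
  by_contra hg
  exact not_isIso_comp hf g (hB.isIso _ fun h => hg (by rwa [← cancel_epi f, comp_zero]))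

/-- A torsion class containing a nonzero subobject of a brick `B` and the lower star of `T(B)`
contains `B`. -/
lemma mem_of_ne_zero {x : Tors C} (hx : objTors B ⊓ objLeftTors B ≤ x) {U : C} (f : U ⟶ B)
    (hU : x.1 U) (hf : f ≠ 0) : x.1 B :=
  prop_of_prop_cokernel x.2.extensions (image.ι f) (x.2.of_image f hU)
    (hx _ (hB.properQuot_mem (cokernel.π (image.ι f))
      (not_isIso_cokernel_π (image_ι_ne_zero hf))))

lemma kappa_eq : kappa (objTors B) = objLeftTors B := by
  rw [kappa, hB.lowerStar_eq]
  refine le_antisymm (sSup_le fun x hx U hU => ?_) (le_sSup rfl)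
  refine objLeftTors_iff.2 fun f => ?_
  by_contra hf
  have hx' : objTors B ⊓ x = objTors B ⊓ objLeftTors B := hx
  have h : (objTors B ⊓ x).1 B := tors_inf_iff.2
    ⟨objTors_self B, hB.mem_of_ne_zero (hx'.ge.trans inf_le_right) f hU hf⟩
  rw [hx'] at h
  exact not_objLeftTors_self hB.not_isZero (tors_inf_iff.1 h).2

end IsBrick

/-- Take `B` in `j`, torsion-free for `j_*`, with proper quotients in `j_*`. The image of a non-mono
endomorphism is both torsion and torsion-free for `j_*`, hence zero; finite length handles mono
ones. If T(B) were smaller than `j`, it would lie below `j_*`. -/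
lemma CompletelyJoinIrreducible.exists_isBrick {j : Tors C} (hj : CompletelyJoinIrreducible j) :
    ∃ B, IsBrick B ∧ objTors B = j := by
  have hlt := lowerStar_lt hj
  obtain ⟨B, hBj, hB, hB0, hquot⟩ := exists_properQuot_mem_of_not_le hlt.not_ge
  refine ⟨B, ⟨hB0, fun f hf => ?_⟩, ?_⟩
  · by_cases hm : Mono f
    · exact isIso_of_mono_endo f
    · refine absurd ?_ (not_isZero_image hf)
      refine isZero_of_rightOrthogonal (hquot _ (factorThruImage f) inferInstance fun _ => hm ?_)
        (rightOrthogonal_of_mono (image.ι f) hB)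
      rw [← image.fac f]
      infer_instance
  · by_contra hne
    have : objTors B ≤ lowerStar j :=
      le_sSup (lt_of_le_of_ne (objTors_le_iff.2 hBj) hne)
    exact hB0 (isZero_of_rightOrthogonal (objTors_le_iff.1 this) hB)

lemma objTors_eq_of_isIso {B B' : C} (f : B ⟶ B') [IsIso f] : objTors B = objTors B' :=
  le_antisymm (objTors_le_iff.2 ((objTors B').2.of_epi (inv f) (objTors_self B')))
    (objTors_le_iff.2 ((objTors B).2.of_epi f (objTors_self B)))

namespace IsSemibrick

variable {S : ObjectProperty C} (hS : IsSemibrick S)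

include hS

/-- If no joinand contains `B`, all lie in ⊥B by `le_objLeftTors`, hence so does T(S), yet `B` is in
T(S). -/
theorem isCanonicalJoinRep :
    IsCanonicalJoinRep {j | ∃ B, S B ∧ objTors B = j} (torsClosure S) where
  sSup_eq := sSup_objTors S
  refines := by
    rintro 𝓑 h𝓑 _ ⟨B, hB, rfl⟩
    by_contra! hcon
    have hle : torsClosure S ≤ objLeftTors B := by
      conv_lhs => rw [← h𝓑]
      refine sSup_le fun b hb => hS.le_objLeftTors hB (h𝓑 ▸ le_sSup hb) fun hbB => ?_
      exact hcon b hb (objTors_le_iff.2 hbB)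
    exact not_objLeftTors_self (hS.not_isZero B hB) (hle B (le_torsClosure S B hB))
  antichain := by
    rintro _ ⟨B, hB, rfl⟩ _ ⟨B', hB', rfl⟩ hle
    obtain ⟨s, f, hs, hf⟩ := exists_from_of_torsHull
      (torsClosure_iff.1 (objTors_le_iff.1 hle)) (hS.not_isZero B hB)
    obtain rfl := (ObjectProperty.singleton_iff _ _).1 hs
    have := hS.isIso f hB' hB hf
    exact (objTors_eq_of_isIso f).symm

lemma lt_torsClosure_iff {b : Tors C} :
    b < torsClosure S ↔ ∃ B, S B ∧ b ≤ torsClosure S ⊓ objLeftTors B := by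
  constructor
  · intro h
    obtain ⟨B, hB, hbB⟩ : ∃ B, S B ∧ ¬ b.1 B := by
      by_contra! hcon
      exact h.not_ge (torsClosure_le_iff.2 hcon)
    exact ⟨B, hB, le_inf h.le (hS.le_objLeftTors hB h.le hbB)⟩
  · rintro ⟨B, hB, hb⟩
    refine lt_of_le_not_ge (hb.trans inf_le_left) fun h => ?_
    exact not_objLeftTors_self (hS.not_isZero B hB)
      ((h.trans (hb.trans inf_le_right)) B (le_torsClosure S B hB))

lemma inf_objLeftTors_covBy {B : C} (hB : S B) :
    torsClosure S ⊓ objLeftTors B ⋖ torsClosure S := by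
  refine ⟨hS.lt_torsClosure_iff.2 ⟨B, hB, le_rfl⟩, fun b hb hb' => hb'.not_ge ?_⟩
  have hbB : b.1 B := by
    by_contra hbB
    exact hb.not_ge (le_inf hb'.le (hS.le_objLeftTors hB hb'.le hbB))
  refine torsClosure_le_iff.2 fun B' hB' => ?_
  by_cases h : (objLeftTors B).1 B'
  · exact hb.le B' (tors_inf_iff.2 ⟨le_torsClosure S B' hB', h⟩)
  · rw [objLeftTors_iff] at h
    push Not at h
    obtain ⟨f, hf⟩ := h
    have := hS.isIso f hB' hB hf
    exact b.2.of_epi (inv f) hbB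

/-- The lower covers of T(S) are exactly the T(S) ∩ ⊥B with `B` in `S`. -/
lemma downArrow_eq : downArrow (torsClosure S) = torsClosure S ⊓ leftTors S := by
  refine le_antisymm (le_inf inf_le_left ?_) (le_inf inf_le_left (le_sInf fun b hb => ?_))
  · intro X hX Y f hY
    have := tors_sInf_iff.1 (tors_inf_iff.1 hX).2 _ (hS.inf_objLeftTors_covBy hY)
    exact objLeftTors_iff.1 (tors_inf_iff.1 this).2 f
  · obtain ⟨B, hB, hle⟩ := hS.lt_torsClosure_iff.1 hb.lt
    have heq : b = torsClosure S ⊓ objLeftTors B := by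
      refine hle.eq_of_not_lt fun hlt => hb.2 hlt ?_
      exact hS.lt_torsClosure_iff.2 ⟨B, hB, le_rfl⟩
    rw [heq]
    exact inf_le_inf_left _ (leftTors_le_objLeftTors hB)

lemma cjr_eq {x : L₀ (Tors C)} (hx : x.1 = torsClosure S) :
    CJR x = {j | ∃ B, S B ∧ objTors B = j} :=
  (Classical.choose_spec x.2).unique (hx ▸ hS.isCanonicalJoinRep)

lemma extKappa_eq {x : L₀ (Tors C)} (hx : x.1 = torsClosure S) : extKappa x = leftTors S := by
  rw [extKappa, hS.cjr_eq hx]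
  refine le_antisymm (fun X hX B f hB => ?_) (le_sInf ?_)
  · have := tors_sInf_iff.1 hX _ ⟨_, ⟨B, hB, rfl⟩, rfl⟩
    rw [(hS.isBrick hB).kappa_eq] at this
    exact objLeftTors_iff.1 this f
  · rintro _ ⟨_, ⟨B, hB, rfl⟩, rfl⟩
    rw [(hS.isBrick hB).kappa_eq]
    exact leftTors_le_objLeftTors hB

lemma objTors_mem_jlabel_iff {B : C} (hB : IsBrick B) :
    objTors B ∈ jlabel (downArrow (torsClosure S)) (torsClosure S) ↔
      (torsHull S ⊓ torfHull S) B := by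
  rw [jlabel, Set.mem_ofPred_eq, hB.kappa_eq, hS.downArrow_eq, objTors_le_iff, torsClosure_iff]
  constructor
  · rintro ⟨-, h, h'⟩
    refine ⟨h, hS.torfHull_of_cancel h fun U f hU hU' => ?_⟩
    exact objLeftTors_iff.1 (h' U (tors_inf_iff.2 ⟨torsClosure_iff.2 hU, hU'⟩)) f
  · rintro ⟨h, h'⟩
    refine ⟨hB.completelyJoinIrreducible, h, fun U hU => objLeftTors_iff.2 fun f => ?_⟩
    exact h' f (tors_inf_iff.1 hU).2

end IsSemibrick

/-- Canonical join representations in the lattice of torsion classes come from semibricks. -/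
theorem IsCanonicalJoinRep.exists_isSemibrick {A : Set (Tors C)} {x : Tors C}
    (hA : IsCanonicalJoinRep A x) : ∃ S : ObjectProperty C, IsSemibrick S ∧ x = torsClosure S := by
  have : Nonempty C := ⟨(HasZeroObject.zero (C := C)).choose⟩
  have hbrick := fun a (ha : a ∈ A) => (hA.completelyJoinIrreducible ha).exists_isBrick
  choose! B hB hBA using hbrick
  have hAB : {j | ∃ X, (∃ a ∈ A, B a = X) ∧ objTors X = j} = A := by
    ext j
    constructor
    · rintro ⟨_, ⟨a, ha, rfl⟩, rfl⟩
      rwa [hBA a ha]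
    · exact fun hj => ⟨B j, ⟨j, hj, rfl⟩, hBA j hj⟩
  refine ⟨fun X => ∃ a ∈ A, B a = X, ⟨?_, ?_⟩, ?_⟩
  · rintro _ ⟨a, ha, rfl⟩
    exact (hB a ha).not_isZero
  · rintro _ _ f ⟨a, ha, rfl⟩ ⟨a', ha', rfl⟩ hf
    by_cases haa : a = a'
    · subst haa
      exact (hB a ha).isIso f hf
    -- Proper quotients of `B a'` lie in `lowerStar a'`, so a nonzero map from `B a` puts `B a'` in
    -- the join of `a` and `lowerStar a'`. Then `a'` could be replaced by `lowerStar a'`.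
    · have h' := (hB a' ha').lowerStar_eq
      rw [hBA a' ha'] at h'
      have := hA.mem_of_sSup_eq ha' {lowerStar a'} (by
        rintro _ rfl
        exact (lowerStar_lt (hA.completelyJoinIrreducible ha')).le) (by
        conv_lhs => rw [← hBA a' ha']
        refine objTors_le_iff.2 ((hB a' ha').mem_of_ne_zero ?_ f ?_ hf)
        · rw [hBA a' ha', ← h']
          exact le_sSup (Or.inr rfl)
        · refine le_sSup (a := a) (Or.inl ⟨ha, haa⟩) _ ?_
          exact objTors_le_iff.1 (hBA a ha).le)
      exact absurd (Set.mem_singleton_iff.1 this).symm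
        (lowerStar_lt (hA.completelyJoinIrreducible ha')).ne
  · rw [← sSup_objTors, hAB, hA.sSup_eq]

end Brick

/-! ### The bijection and the two orders -/

section Correspondence

variable {C : Type u} [Category.{v} C] [Abelian C] [FiniteLength C]

lemma exists_isSemibrick (x : L₀ (Tors C)) :
    ∃ S : ObjectProperty C, IsSemibrick S ∧ x.1 = torsClosure S :=
  x.2.choose_spec.exists_isSemibrick

lemma torsClosure_inf_hulls (S : ObjectProperty C) :
    torsClosure (torsHull S ⊓ torfHull S) = torsClosure S :=
  le_antisymm (torsClosure_le_iff.2 fun _ hX => torsClosure_iff.2 hX.1)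
    (torsClosure_le_iff.2 fun X hX =>
      le_torsClosure _ X ⟨torsHull_of_prop hX, torfHull_of_prop hX⟩)

/-- The wide subcategory `x ∩ κ̄(x)^⊥` attached to `x ∈ L₀`. -/
def wideProp (x : L₀ (Tors C)) : ObjectProperty C := x.1.1 ⊓ (extKappa x).1.rightOrthogonal

lemma IsSemibrick.wideProp_eq {S : ObjectProperty C} (hS : IsSemibrick S) {x : L₀ (Tors C)}
    (hx : x.1 = torsClosure S) : wideProp x = torsHull S ⊓ torfHull S := by
  rw [wideProp, hS.extKappa_eq hx, hx, torsClosure_eq]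
  rfl

/-- `W ↦ T(W)`, as a map from wide subcategories to `L₀`. -/
def wideToTors (W : Wide C) : L₀ (Tors C) :=
  ⟨torsClosure W.1, _, W.2.torsClosure_wideSimples ▸
    (isSemibrick_wideSimples W.1).isCanonicalJoinRep⟩

/-- `x ↦ x ∩ κ̄(x)^⊥`, as a map from `L₀` to wide subcategories. -/
def torsToWide (x : L₀ (Tors C)) : Wide C :=
  ⟨wideProp x, by
    obtain ⟨S, hS, hx⟩ := exists_isSemibrick x
    rw [hS.wideProp_eq hx]
    exact hS.isWide⟩

/-- Wide subcategories correspond to torsion classes with a canonical join representation. -/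
def wideEquiv : Wide C ≃ L₀ (Tors C) where
  toFun := wideToTors
  invFun := torsToWide
  left_inv W := Subtype.ext (((isSemibrick_wideSimples W.1).wideProp_eq (x := wideToTors W)
    W.2.torsClosure_wideSimples.symm).trans W.2.eq_hulls)
  right_inv x := Subtype.ext (by
    obtain ⟨S, hS, hx⟩ := exists_isSemibrick x
    change torsClosure (wideProp x) = x.1
    rw [hS.wideProp_eq hx, torsClosure_inf_hulls, hx])

/-- For the converse, `S` lies in `wideProp x`, hence in T(S') and F(S'); the first gives x ≤ y, the
second ⊥S' ≤ ⊥S. -/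
lemma kappaLE_iff_wideProp_le (x y : L₀ (Tors C)) : KappaLE x y ↔ wideProp x ≤ wideProp y := by
  constructor
  · exact fun h X hX => ⟨h.1 X hX.1, fun U f hU => hX.2 f (h.2 U hU)⟩
  · intro h
    obtain ⟨S, hS, hx⟩ := exists_isSemibrick x
    obtain ⟨S', hS', hy⟩ := exists_isSemibrick y
    rw [hS.wideProp_eq hx, hS'.wideProp_eq hy] at h
    rw [KappaLE, hS.extKappa_eq hx, hS'.extKappa_eq hy, hx, hy]
    have hSS : ∀ X, S X → (torsHull S' ⊓ torfHull S') X := fun X hX =>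
      h X ⟨torsHull_of_prop hX, torfHull_of_prop hX⟩
    exact ⟨torsClosure_le_iff.2 fun X hX => torsClosure_iff.2 (hSS X hX).1,
      fun U hU X f hX => (hSS X hX).2 f hU⟩

/-- Labels are the bricks of `wideProp`. The members of `S` are among them, and they determine both
hulls. -/
lemma coreLabelLE_iff_wideProp_le (x y : L₀ (Tors C)) :
    CoreLabelLE x y ↔ wideProp x ≤ wideProp y := by
  obtain ⟨S, hS, hx⟩ := exists_isSemibrick x
  obtain ⟨S', hS', hy⟩ := exists_isSemibrick y
  rw [hS.wideProp_eq hx, hS'.wideProp_eq hy, CoreLabelLE, hx, hy]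
  constructor
  · intro h
    have hSS : ∀ X, S X → (torsHull S' ⊓ torfHull S') X := fun X hX =>
      (hS'.objTors_mem_jlabel_iff (hS.isBrick hX)).1
        (h ((hS.objTors_mem_jlabel_iff (hS.isBrick hX)).2
          ⟨torsHull_of_prop hX, torfHull_of_prop hX⟩))
    exact fun X hX => ⟨fun Y f hY => hX.1 f fun U g hU => (hSS U hU).1 g hY,
      fun Y f hY => hX.2 f fun U g hU => (hSS U hU).2 g hY⟩
  · intro h j hj
    obtain ⟨B, hB, rfl⟩ := hj.1.exists_isBrick
    exact (hS'.objTors_mem_jlabel_iff hB).2 (h B ((hS.objTors_mem_jlabel_iff hB).1 hj))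

lemma wideProp_injective : Function.Injective (wideProp (C := C)) := fun _ _ h =>
  wideEquiv.symm.injective (Subtype.ext h)

instance isPartialOrder_kappaLE : IsPartialOrder (L₀ (Tors C)) KappaLE where
  refl x := (kappaLE_iff_wideProp_le x x).2 le_rfl
  trans x y z h h' := (kappaLE_iff_wideProp_le x z).2
    (((kappaLE_iff_wideProp_le x y).1 h).trans ((kappaLE_iff_wideProp_le y z).1 h'))
  antisymm x y h h' := wideProp_injective
    (le_antisymm ((kappaLE_iff_wideProp_le x y).1 h) ((kappaLE_iff_wideProp_le y x).1 h'))

lemma kappaLE_iff_coreLabelLE (x y : L₀ (Tors C)) : KappaLE x y ↔ CoreLabelLE x y :=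
  (kappaLE_iff_wideProp_le x y).trans (coreLabelLE_iff_wideProp_le x y).symm

lemma le_iff_kappaLE_wideEquiv (W₁ W₂ : Wide C) :
    W₁ ≤ W₂ ↔ KappaLE (wideEquiv W₁) (wideEquiv W₂) := by
  rw [kappaLE_iff_wideProp_le]
  conv_lhs => rw [← wideEquiv.symm_apply_apply W₁, ← wideEquiv.symm_apply_apply W₂]
  exact Iff.rfl

end Correspondence

end TorsLattice

theorem corollary4 (C : Type u) [Category.{v} C] [Abelian C]
    (hC : TorsLattice.IsLengthCategory C) :
    TorsLattice.CompletelySemidistributive (TorsLattice.Tors C) ∧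
    IsPartialOrder (TorsLattice.L₀ (TorsLattice.Tors C)) TorsLattice.KappaLE ∧
    IsPartialOrder (TorsLattice.L₀ (TorsLattice.Tors C)) TorsLattice.CoreLabelLE ∧
    (∀ x y : TorsLattice.L₀ (TorsLattice.Tors C),
      TorsLattice.KappaLE x y ↔ TorsLattice.CoreLabelLE x y) ∧
    ∃ e : TorsLattice.Wide C ≃ TorsLattice.L₀ (TorsLattice.Tors C),
      (∀ W : TorsLattice.Wide C,
        (e W : TorsLattice.Tors C) = TorsLattice.torsClosure (W : ObjectProperty C)) ∧
      (∀ W₁ W₂ : TorsLattice.Wide C, W₁ ≤ W₂ ↔ TorsLattice.KappaLE (e W₁) (e W₂)) ∧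
      (∀ W₁ W₂ : TorsLattice.Wide C, W₁ ≤ W₂ ↔ TorsLattice.CoreLabelLE (e W₁) (e W₂)) := by
  have := hC.finiteLength
  have hK := TorsLattice.isPartialOrder_kappaLE (C := C)
  have hKC : TorsLattice.KappaLE (L := TorsLattice.Tors C) = TorsLattice.CoreLabelLE := by
    funext x y
    exact propext (TorsLattice.kappaLE_iff_coreLabelLE x y)
  exact ⟨TorsLattice.completelySemidistributive_tors, hK, hKC ▸ hK,
    TorsLattice.kappaLE_iff_coreLabelLE, TorsLattice.wideEquiv, fun _ => rfl,
    TorsLattice.le_iff_kappaLE_wideEquiv, fun W₁ W₂ =>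
      (TorsLattice.le_iff_kappaLE_wideEquiv W₁ W₂).trans
        (TorsLattice.kappaLE_iff_coreLabelLE _ _)⟩
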